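/- Algebras have finitary operations and non-empty universes. A finite algebra $\mathbf Q$ is *quasi-primal* if the ternary discriminator $\tau$ on $Q$, where $\tau(x,y,z)=x$ if $x\neq y$ and $\tau(x,y,z)=z$ if $x=y$, is a term function of $\mathbf Q$. For algebras $\mathbf A,\mathbf B$ of the same signature write $\mathbf A\to\mathbf B$ if there is a homomorphism from $\mathbf A$ to $\mathbf B$, and $\mathbf A\equiv\mathbf B$ if $\mathbf A\to\mathbf B$ and $\mathbf B\to\mathbf A$. Let $\operatorname{Var}(\mathbf Q)_{\mathrm{fin}}$ be the class of finite algebras in the variety generated by $\mathbf Q$, and let $\mathbf L_{\mathbf Q}=\langle \operatorname{Var}(\mathbf Q)_{\mathrm{fin}}/{\equiv};\to\rangle$ be the ordered set of its $\equiv$-classes, ordered by $\to$. For an ordered set $\mathbf P$ let $\mathcal O(\mathbf P)$ denote the lattice of all down-sets of $\mathbf P$ (including the empty one), ordered by inclusion. **Theorem.** Let $\mathbf Q$ be a quasi-primal algebra, let $\operatorname{Sub}(\mathbf Q)$ be the set of all subalgebras of $\mathbf Q$, let $\mathbf P=\langle \operatorname{Sub}(\mathbf Q)/{\equiv};\to\rangle$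 be the ordered set of $\equiv$-classes of subalgebras, ordered by $\to$, and let $\overline{\mathbf P}$ denote $\mathbf P$ without its top element $\mathbf Q/{\equiv}$. (i) If $\mathbf Q$ has no trivial (that is, one-element) subalgebras, then $\mathbf L_{\mathbf Q}\cong\mathcal O(\mathbf P)$. (ii) If $\mathbf Q$ has a trivial subalgebra, then $\mathbf L_{\mathbf Q}\cong\mathcal O(\overline{\mathbf P})$. Consequently, $\mathbf L_{\mathbf Q}$ is always a finite distributive lattice. -/

import Mathlib

open FirstOrder

universe u v w

namespace HomOrder

/-- The ternary discriminator operation on `Q`: `τ(x, y, z) = x` if `x ≠ y`, and `z` if `x = y`. -/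
noncomputable def discriminator {Q : Type u} (x y z : Q) : Q :=
  open Classical in if x = y then z else x

/-- A finite algebra is quasi-primal if the ternary discriminator is one of its term functions. -/
structure IsQuasiPrimal (L : FirstOrder.Language.{v, w}) (Q : Type u) [L.Structure Q] : Prop where
  finite : Finite Q
  discriminator_term : ∃ t : L.Term (Fin 3), ∀ x y z : Q,
    t.realize ![x, y, z] = discriminator x y z

/-- `B` lies in the variety `Var(A)` generated by `A`: every equation `s ≈ t` (in the variables
`x₀, x₁, …`) that is true in `A` is true in `B`. -/
def InVariety (L : FirstOrder.Language.{v, w}) (A : Type u) [L.Structure A] (B : Type u) [L.Structure B] :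
    Prop :=
  ∀ s t : L.Term ℕ, (∀ a : ℕ → A, s.realize a = t.realize a) →
    ∀ b : ℕ → B, s.realize b = t.realize b

/-- `Var(A)_fin`: the finite (non-empty) algebras in the variety generated by `A`. -/
structure VarFin (L : FirstOrder.Language.{v, w}) (A : Type u) [L.Structure A] where
  carrier : Type u
  [str : L.Structure carrier]
  [nonempty : Nonempty carrier]
  [finite : Finite carrier]
  mem : InVariety L A carrier

attribute [instance] VarFin.str VarFin.nonempty VarFin.finite

/-- The quasi-order `B → C`: there is a homomorphism from `B` to `C`. -/
instance VarFin.instPreorder (L : FirstOrder.Language.{v, w}) (A : Type u) [L.Structure A] :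
    Preorder (VarFin L A) where
  le B C := Nonempty (B.carrier →[L] C.carrier)
  le_refl B := ⟨FirstOrder.Language.Hom.id L B.carrier⟩
  le_trans _ _ _ := fun ⟨f⟩ ⟨g⟩ => ⟨g.comp f⟩

/-- The ordered set `L_A = ⟨Var(A)_fin / ≡; →⟩`, where `B ≡ C` means `B → C` and `C → B`. -/
abbrev HomLattice (L : FirstOrder.Language.{v, w}) (A : Type u) [L.Structure A] :=
  Antisymmetrization (VarFin L A) (· ≤ ·)

/-- `Sub(A)`: the (non-empty) subalgebras of `A`. -/
structure Subalgebras (L : FirstOrder.Language.{v, w}) (A : Type u) [L.Structure A] where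
  toSubstructure : L.Substructure A
  nonempty : (toSubstructure : Set A).Nonempty

/-- The quasi-order `S → T` (not inclusion): there is a homomorphism from `S` to `T`. -/
instance Subalgebras.instPreorder (L : FirstOrder.Language.{v, w}) (A : Type u) [L.Structure A] :
    Preorder (Subalgebras L A) where
  le S T := Nonempty (S.toSubstructure →[L] T.toSubstructure)
  le_refl S := ⟨FirstOrder.Language.Hom.id L S.toSubstructure⟩
  le_trans _ _ _ := fun ⟨f⟩ ⟨g⟩ => ⟨g.comp f⟩

/-- The ordered set `P = ⟨Sub(A) / ≡; →⟩`. -/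
abbrev SubOrder (L : FirstOrder.Language.{v, w}) (A : Type u) [L.Structure A] :=
  Antisymmetrization (Subalgebras L A) (· ≤ ·)

/-- `A` regarded as a subalgebra of itself. -/
def Subalgebras.whole (L : FirstOrder.Language.{v, w}) (A : Type u) [L.Structure A] [Nonempty A] :
    Subalgebras L A :=
  ⟨⊤, Set.univ_nonempty⟩

/-- The top of `P` is the class of `A` itself. -/
instance SubOrder.instOrderTop (L : FirstOrder.Language.{v, w}) (A : Type u) [L.Structure A] [Nonempty A] :
    OrderTop (SubOrder L A) where
  top := toAntisymmetrization (· ≤ ·) (Subalgebras.whole L A)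
  le_top p := by
    induction p using Quotient.inductionOn with
    | h S => exact ⟨(FirstOrder.Language.Substructure.inclusion (le_top : S.toSubstructure ≤ ⊤)).toHom⟩

/-- `P` without its top. -/
abbrev SubOrderNoTop (L : FirstOrder.Language.{v, w}) (A : Type u) [L.Structure A] [Nonempty A] :=
  {p : SubOrder L A // p ≠ ⊤}

/-- `A` has a trivial, that is, one-element, subalgebra. -/
def HasTrivialSubalgebra (L : FirstOrder.Language.{v, w}) (A : Type u) [L.Structure A] : Prop :=
  ∃ S : Subalgebras L A, ∃ a : A, (S.toSubstructure : Set A) = {a}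

/-- The given order on `X` is the order of a distributive lattice. -/
def IsDistribLatticeOrder (X : Type u) [P : PartialOrder X] : Prop :=
  ∃ D : DistribLattice X, ∀ a b : X, D.le a b ↔ P.le a b

end HomOrder

/-! A finite algebra `B` in the variety is determined up to `≡` by the idempotent-free subalgebras
`S` of `Q` with no homomorphism `B → S`; their classes form a down-set. Everything rests on a
switching term built from the discriminator.

Order embedding: by `exists_finset_range_eq` a target `C` is a product of subalgebras of `Q`, so `B
→ C` iff `B` maps to each factor. A factor with an idempotent admits a constant map, so only
idempotent-free ones obstruct (`le_of_forall`).

Surjectivity: a down-set comes from the product of the subalgebras outside it, since a homomorphism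
from a finite product to an idempotent-free subalgebra depends on one coordinate only
(`exists_hom_of_pi`).

If `Q` has no trivial subalgebra, all of `P` counts; otherwise the subalgebras with an idempotent
are exactly those in the top class. -/

namespace HomOrder

open FirstOrder.Language

/-! ### Homomorphisms, products and idempotents -/

section Algebra

variable {L : FirstOrder.Language.{v, w}}

/-- In an algebraic language, a map commuting with the operations is a homomorphism. -/
def homOfMapFun [L.IsAlgebraic] {M N : Type*} [L.Structure M] [L.Structure N] (g : M → N)
    (hg : ∀ {n : ℕ} (f : L.Functions n) (x : Fin n → M),
      g (Structure.funMap f x) = Structure.funMap f (g ∘ x)) : M →[L] N where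
  toFun := g
  map_fun' := hg
  map_rel' r := isEmptyElim r

/-- The product structure. -/
instance piStructure {ι : Type*} (M : ι → Type*) [∀ i, L.Structure (M i)] :
    L.Structure (∀ i, M i) where
  funMap f x i := Structure.funMap f fun k => x k i
  RelMap r x := ∀ i, Structure.RelMap r fun k => x k i

/-- The projections from a product are homomorphisms. -/
def projHom {ι : Type*} (M : ι → Type*) [∀ i, L.Structure (M i)] (i : ι) :
    (∀ i, M i) →[L] M i where
  toFun x := x i
  map_fun' _ _ := rfl
  map_rel' _ _ h := h i

/-- The homomorphism into a product given by its components. -/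
def piHom {ι M : Type*} {N : ι → Type*} [L.Structure M] [∀ i, L.Structure (N i)]
    (g : ∀ i, M →[L] N i) : M →[L] (∀ i, N i) where
  toFun x i := g i x
  map_fun' f x := funext fun i => (g i).map_fun f x
  map_rel' r x h := fun i => (g i).map_rel r x h

/-- A homomorphism with values in a substructure, with restricted codomain. -/
def codHom {M N : Type*} [L.Structure M] [L.Structure N] (g : M →[L] N) (S : L.Substructure N)
    (h : ∀ x, g x ∈ S) : M →[L] S where
  toFun x := ⟨g x, h x⟩
  map_fun' f x := Subtype.ext (g.map_fun f x)
  map_rel' r x hx := g.map_rel r x hx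

/-- `a` is a fixed point of all operations, that is, `{a}` is a subalgebra. -/
def IsIdempotentPoint (L : FirstOrder.Language.{v, w}) {M : Type*} [L.Structure M] (a : M) : Prop :=
  ∀ (n : ℕ) (f : L.Functions n), Structure.funMap f (fun _ => a) = a

theorem IsIdempotentPoint.map {M N : Type*} [L.Structure M] [L.Structure N] {a : M}
    (ha : IsIdempotentPoint L a) (g : M →[L] N) : IsIdempotentPoint L (g a) := fun n f =>
  (g.map_fun f fun _ => a).symm.trans (congrArg g (ha n f))

/-- The constant homomorphism onto an idempotent point. -/
def constHom [L.IsAlgebraic] (M : Type*) {N : Type*} [L.Structure M] [L.Structure N] {a : N}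
    (ha : IsIdempotentPoint L a) : M →[L] N :=
  homOfMapFun (fun _ => a) fun f _ => (ha _ f).symm

theorem isIdempotentPoint_of_hom_const {M N : Type*} [Nonempty M] [L.Structure M] [L.Structure N]
    (g : M →[L] N) (hg : ∀ x y, g x = g y) (x : M) : IsIdempotentPoint L (g x) := fun _ f =>
  (g.map_fun f fun _ => x).symm.trans (hg _ _)

theorem hasTrivialSubalgebra_iff {A : Type u} [L.Structure A] :
    HasTrivialSubalgebra L A ↔ ∃ a : A, IsIdempotentPoint L a := by
  constructor
  · rintro ⟨S, a, hS⟩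
    have mem : ∀ x, x ∈ S.toSubstructure ↔ x = a := fun x => by
      rw [← SetLike.mem_coe, hS, Set.mem_singleton_iff]
    exact ⟨a, fun _ f => (mem _).1 (S.toSubstructure.fun_mem f _ fun _ => (mem a).2 rfl)⟩
  · rintro ⟨a, ha⟩
    refine ⟨⟨⟨{a}, fun f x hx => ?_⟩, ⟨a, rfl⟩⟩, a, rfl⟩
    have : x = fun _ => a := funext hx
    rw [this]
    exact ha _ f

instance Subalgebras.instNonempty {A : Type u} [L.Structure A] (S : Subalgebras L A) :
    Nonempty S.toSubstructure :=
  S.nonempty.to_subtype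

instance Subalgebras.instFinite {A : Type u} [L.Structure A] [Finite A] :
    Finite (Subalgebras L A) :=
  Finite.of_injective (fun S : Subalgebras L A => (S.toSubstructure : Set A)) <| by
    rintro ⟨S, _⟩ ⟨T, _⟩ h
    obtain rfl : S = T := SetLike.coe_injective h
    rfl

/-- The subalgebra has no one-element subalgebra. -/
def Subalgebras.NoIdempotent {A : Type u} [L.Structure A] (S : Subalgebras L A) : Prop :=
  ∀ a : S.toSubstructure, ¬ IsIdempotentPoint L a

/-- The range of a homomorphism, as a subalgebra. -/
def Subalgebras.range {A : Type u} {M : Type*} [Nonempty M] [L.Structure A] [L.Structure M]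
    (g : M →[L] A) : Subalgebras L A :=
  ⟨g.range, ⟨g (Classical.arbitrary M), g.mem_range_self _⟩⟩

/-- Frees the variables from `ℕ`, so that elements of a finite algebra can serve as variables. -/
theorem InVariety.realize_eq {A B : Type u} [L.Structure A] [L.Structure B] [Nonempty B]
    (h : InVariety L A B) {α : Type*} [Countable α] {s t : L.Term α}
    (hA : ∀ a : α → A, s.realize a = t.realize a) (b : α → B) : s.realize b = t.realize b := by
  obtain ⟨e, he⟩ := exists_injective_nat α
  have := h (s.relabel e) (t.relabel e) (fun a => by simpa using hA (a ∘ e))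
    (Function.extend e b fun _ => Classical.arbitrary B)
  simpa only [Term.realize_relabel, he.extend_comp, Function.extend_comp he] using this

theorem InVariety.of_separating {A B : Type u} [L.Structure A] [L.Structure B] {ι : Type*}
    (g : ι → B →[L] A) (hg : ∀ x y, (∀ i, g i x = g i y) → x = y) : InVariety L A B :=
  fun s t hst b => hg _ _ fun i => by
    rw [← HomClass.realize_term (g i), ← HomClass.realize_term (g i), hst]

end Algebra

/-! ### The switching term and its consequences -/

section Switching

variable {L : FirstOrder.Language.{v, w}} {Q : Type u} [L.Structure Q]

/-- The term `t(x, y, u, v)` has value `u` if `x = y`, and `v` otherwise. -/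
def IsSwitching (Q : Type u) [L.Structure Q] (t : L.Term (Fin 4)) : Prop :=
  (∀ x u v : Q, t.realize ![x, x, u, v] = u) ∧
    ∀ x y u v : Q, x ≠ y → t.realize ![x, y, u, v] = v

/-- Substitution in a quaternary term. -/
def subst₄ {α : Type*} (t : L.Term (Fin 4)) (a b c d : L.Term α) : L.Term α :=
  t.subst ![a, b, c, d]

theorem realize_subst₄ {α M : Type*} [L.Structure M] (t : L.Term (Fin 4)) (a b c d : L.Term α)
    (e : α → M) : (subst₄ t a b c d).realize e =
      t.realize ![a.realize e, b.realize e, c.realize e, d.realize e] := by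
  rw [subst₄, Term.realize_subst]
  congr 1
  funext i
  fin_cases i <;> rfl

theorem map_realize₄ {M N : Type*} [L.Structure M] [L.Structure N] (g : M →[L] N)
    (t : L.Term (Fin 4)) (a b c d : M) :
    g (t.realize ![a, b, c, d]) = t.realize ![g a, g b, g c, g d] := by
  rw [← HomClass.realize_term g]
  congr 1
  funext i
  fin_cases i <;> rfl

theorem IsQuasiPrimal.exists_isSwitching (hQ : IsQuasiPrimal L Q) :
    ∃ t : L.Term (Fin 4), IsSwitching Q t := by
  obtain ⟨d, hd⟩ := hQ.discriminator_term
  let p : L.Term (Fin 4) := d.subst ![Term.var 0, Term.var 1, Term.var 2]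
  let q : L.Term (Fin 4) := d.subst ![Term.var 0, Term.var 1, Term.var 3]
  have key : ∀ (a b c : L.Term (Fin 4)) (e : Fin 4 → Q), (d.subst ![a, b, c]).realize e =
      discriminator (a.realize e) (b.realize e) (c.realize e) := fun a b c e => by
    rw [Term.realize_subst, ← hd]
    congr 1
    funext i
    fin_cases i <;> rfl
  have eq_self : ∀ x z : Q, discriminator x x z = z := fun _ _ => if_pos rfl
  have of_ne : ∀ x y z : Q, x ≠ y → discriminator x y z = x := fun _ _ _ h => if_neg h
  -- For `x ≠ y` both `p` and `q` equal `x`; for `x = y` they are `u` and `v`, and `τ(u, v, v) = u`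
  -- in either case.
  refine ⟨d.subst ![p, q, Term.var 3], fun x u v => ?_, fun x y u v hxy => ?_⟩
  · simp only [key, p, q, Term.realize_var]
    change discriminator (discriminator x x u) (discriminator x x v) v = u
    rw [eq_self, eq_self]
    by_cases h : u = v
    · rw [h, eq_self]
    · rw [of_ne _ _ _ h]
  · simp only [key, p, q, Term.realize_var]
    change discriminator (discriminator x y u) (discriminator x y v) v = v
    rw [of_ne _ _ _ hxy, of_ne _ _ _ hxy, eq_self]

variable {t : L.Term (Fin 4)}

/-- Only this half of the switching property is an equation, so only it passes to the variety. -/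
theorem IsSwitching.realize_self {B : Type u} [L.Structure B] [Nonempty B] (ht : IsSwitching Q t)
    (hB : InVariety L Q B) (x u v : B) : t.realize ![x, x, u, v] = u := by
  have := hB.realize_eq (s := subst₄ t (Term.var (0 : Fin 3)) (Term.var 0) (Term.var 1) (Term.var 2))
    (t := Term.var 1) (fun a => by rw [realize_subst₄]; exact ht.1 _ _ _) ![x, u, v]
  rwa [realize_subst₄] at this

/-- Homomorphisms into a quasi-primal algebra separate the points of the finite algebras in its
variety. -/
theorem IsSwitching.exists_hom_ne [L.IsAlgebraic] [Finite Q] (ht : IsSwitching Q t) {B : Type u}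
    [L.Structure B] [Nonempty B] [Finite B] (hB : InVariety L Q B) {b c : B} (hbc : b ≠ c) :
    ∃ g : B →[L] Q, g b ≠ g c := by
  classical
  -- Equations true in `B`, its elements being the variables; `Y p` is the solution set of `p` in
  -- `Q`.
  let E := {p : L.Term B × L.Term B // p.1.realize (id : B → B) = p.2.realize id}
  let Y : E → Set (B → Q) := fun p => {x | p.1.1.realize x = p.1.2.realize x}
  have : Nonempty E := ⟨⟨(Term.var b, Term.var b), rfl⟩⟩
  obtain ⟨p, hp⟩ : ∃ p : E, ∀ q : E, Y p ⊆ Y q := by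
    obtain ⟨S, ⟨p, rfl⟩, hS⟩ :=
      (Set.toFinite (Set.range Y)).exists_minimal (Set.range_nonempty Y)
    refine ⟨p, fun q => ?_⟩
    -- Switching merges two equations into one whose solution set is the intersection, so a minimal
    -- solution set is least.
    let r : E := ⟨(subst₄ t p.1.1 p.1.2 q.1.1 p.1.1, subst₄ t p.1.1 p.1.2 q.1.2 p.1.2), by
      simp only [realize_subst₄, p.2, q.2]⟩
    have hr : ∀ x, x ∈ Y r ↔ x ∈ Y p ∧ x ∈ Y q := fun x => by
      simp only [Y, r, Set.mem_ofPred_eq, realize_subst₄]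
      by_cases h : p.1.1.realize x = p.1.2.realize x
      · simp [h, ht.1]
      · simp [ht.2 _ _ _ _ h, h]
    exact fun x hx => ((hr x).1 (hS ⟨r, rfl⟩ (fun y hy => ((hr y).1 hy).1) hx)).2
  obtain ⟨x, hx, hne⟩ : ∃ x ∈ Y p, x b ≠ x c := by
    -- If every solution of `p` identified `b` and `c`, then `t(p₁, p₂, b, c) ≈ c` would hold in
    -- `Q`, hence in `B`, where `p₁ = p₂` turns it into `b = c`.
    by_contra! hcon
    apply hbc
    have h := hB.realize_eq (s := subst₄ t p.1.1 p.1.2 (Term.var b) (Term.var c))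
      (t := Term.var c) (fun x => by
        rw [realize_subst₄]
        by_cases h : p.1.1.realize x = p.1.2.realize x
        · rw [h, ht.1]
          exact hcon x h
        · exact ht.2 _ _ _ _ h) id
    rwa [realize_subst₄, p.2, ht.realize_self hB] at h
  refine ⟨homOfMapFun x fun f y => ?_, hne⟩
  exact (hp ⟨(Term.func f fun i => Term.var (y i), Term.var (Structure.funMap f y)), rfl⟩ hx).symm

/-- A finite algebra in the variety of a quasi-primal algebra is, via a suitable set of homomorphisms
into the quasi-primal algebra, the product of their ranges. -/
theorem IsSwitching.exists_finset_range_eq [L.IsAlgebraic] [Finite Q] (ht : IsSwitching Q t)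
    {B : Type u} [L.Structure B] [Nonempty B] [Finite B] (hB : InVariety L Q B) :
    ∃ H : Finset (B →[L] Q), Function.Bijective
      (piHom fun g : H => codHom g.1 (Subalgebras.range g.1).toSubstructure
        fun x => g.1.mem_range_self x) := by
  classical
  have : Finite (B →[L] Q) := DFunLike.finite _
  have := Fintype.ofFinite (B →[L] Q)
  let sep : Finset (B →[L] Q) → Prop := fun H => ∀ x y : B, (∀ g ∈ H, g x = g y) → x = y
  have hsep : sep Finset.univ := fun x y h => by
    by_contra hxy
    obtain ⟨g, hg⟩ := ht.exists_hom_ne hB hxy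
    exact hg (h g (Finset.mem_univ g))
  obtain ⟨H, hH, hmin⟩ := (Set.toFinite {H | sep H}).exists_minimal ⟨_, hsep⟩
  -- By minimality of `H` some `c`, `d` are separated by `g` alone; `t(c, d, a, b)` then changes `a`
  -- to `b` at coordinate `g` only.
  have patch : ∀ g ∈ H, ∀ a b : B, ∃ z : B, g z = g b ∧ ∀ k ∈ H, k ≠ g → k z = k a := by
    intro g hg a b
    have : ¬ sep (H.erase g) := fun h =>
      Finset.notMem_erase g H (hmin h (Finset.erase_subset _ _) hg)
    simp only [sep, not_forall] at this
    obtain ⟨c, d, hcd, hne⟩ := this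
    have hgcd : g c ≠ g d := fun h => hne <| hH _ _ fun k hk => by
      by_cases hkg : k = g
      · rw [hkg, h]
      · exact hcd k (Finset.mem_erase.2 ⟨hkg, hk⟩)
    refine ⟨t.realize ![c, d, a, b], ?_, fun k hk hkg => ?_⟩
    · rw [map_realize₄, ht.2 _ _ _ _ hgcd]
    · rw [map_realize₄, hcd k (Finset.mem_erase.2 ⟨hkg, hk⟩), ht.1]
  refine ⟨H, fun x y hxy => hH _ _ fun g hg => ?_, fun y => ?_⟩
  · exact congrArg Subtype.val (congrFun hxy ⟨g, hg⟩)
  · have key : ∀ K : Finset (B →[L] Q), K ⊆ H → ∃ x : B, ∀ g : H, g.1 ∈ K → g.1 x = (y g).1 := by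
      intro K
      induction K using Finset.induction_on with
      | empty => exact fun _ => ⟨Classical.arbitrary B, fun g hg => absurd hg (Finset.notMem_empty _)⟩
      | insert g K hgK ih =>
        intro hK
        have hg : g ∈ H := hK (Finset.mem_insert_self g K)
        obtain ⟨x, hx⟩ := ih fun k hk => hK (Finset.mem_insert_of_mem hk)
        obtain ⟨b, hb⟩ : ∃ b, g b = (y ⟨g, hg⟩).1 := (y ⟨g, hg⟩).2
        obtain ⟨z, hz, hz'⟩ := patch g hg x b
        refine ⟨z, fun k hk => ?_⟩
        by_cases hkg : k.1 = g
        · obtain rfl : k = ⟨g, hg⟩ := Subtype.ext hkg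
          exact hz.trans hb
        · rw [hz' _ k.2 hkg]
          exact hx k ((Finset.mem_insert.1 hk).resolve_left hkg)
    obtain ⟨x, hx⟩ := key H subset_rfl
    exact ⟨x, funext fun g => Subtype.ext (hx g g.2)⟩

/-- A homomorphism exists as soon as the target has no obstruction among the subalgebras without
idempotents. -/
theorem IsSwitching.le_of_forall [L.IsAlgebraic] [Finite Q] (ht : IsSwitching Q t) {B C : VarFin L Q}
    (h : ∀ S : Subalgebras L Q, S.NoIdempotent → Nonempty (C.carrier →[L] S.toSubstructure) →
      Nonempty (B.carrier →[L] S.toSubstructure)) : B ≤ C := by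
  obtain ⟨H, hH⟩ := ht.exists_finset_range_eq C.mem
  have hB : ∀ g : H, Nonempty (B.carrier →[L] (Subalgebras.range g.1).toSubstructure) := fun g => by
    by_cases hS : (Subalgebras.range g.1).NoIdempotent
    · exact h _ hS ⟨codHom g.1 _ fun x => g.1.mem_range_self x⟩
    · simp only [Subalgebras.NoIdempotent, not_forall, not_not] at hS
      obtain ⟨a, ha⟩ := hS
      exact ⟨constHom _ ha⟩
  let k := fun g => (hB g).some
  let φ := piHom fun g : H => codHom g.1 (Subalgebras.range g.1).toSubstructure
    fun x => g.1.mem_range_self x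
  let e := Equiv.ofBijective φ hH
  have he : ∀ y, φ (e.symm y) = y := fun y => e.apply_symm_apply y
  refine ⟨(homOfMapFun e.symm fun f y => hH.1 ?_ : _ →[L] C.carrier).comp (piHom k)⟩
  change φ _ = φ _
  rw [he, φ.map_fun]
  congr 1
  funext i
  exact (he _).symm

/-- A homomorphism from a finite product of subalgebras to a subalgebra without idempotents comes from
a homomorphism on one factor. -/
theorem IsSwitching.exists_hom_of_pi [L.IsAlgebraic] (ht : IsSwitching Q t) {ι : Type*} [Finite ι]
    (S : ι → Subalgebras L Q) (T : Subalgebras L Q) (hT : T.NoIdempotent)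
    (φ : (∀ i, (S i).toSubstructure) →[L] T.toSubstructure) :
    ∃ i, Nonempty ((S i).toSubstructure →[L] T.toSubstructure) := by
  classical
  -- `G Z`: `φ` depends only on the coordinates in `Z`. These sets form an ultrafilter on a finite
  -- set, hence a principal one.
  let G : Set ι → Prop := fun Z => ∀ x y : ∀ i, (S i).toSubstructure, (∀ i ∈ Z, x i = y i) → φ x = φ y
  have hcompl : ∀ Z, ¬ G Z → G Zᶜ := by
    intro Z hZ x' y' hxy'
    simp only [G, not_forall] at hZ
    obtain ⟨x, y, hxy, hne⟩ := hZ
    -- Where `x` and `y` differ, the coordinate is outside `Z`, so `x'` and `y'` agree there. In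
    -- `T`, however, the images of `x` and `y` differ, so the term selects `φ y'`.
    have hval : t.realize ![x, y, x', y'] = x' := by
      funext i
      apply Subtype.ext
      change (S i).toSubstructure.subtype.toHom.comp
        (projHom (fun i => (S i).toSubstructure) i) _ = (x' i).1
      rw [map_realize₄]
      change t.realize ![(x i).1, (y i).1, (x' i).1, (y' i).1] = _
      by_cases hi : (x i).1 = (y i).1
      · rw [hi, ht.1]
      · rw [ht.2 _ _ _ _ hi, hxy' i fun hZ => hi (congrArg _ (hxy i hZ))]
    apply Subtype.ext
    have h := map_realize₄ (T.toSubstructure.subtype.toHom.comp φ) t x y x' y'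
    rw [hval] at h
    exact h.trans (ht.2 _ _ _ _ fun h => hne (Subtype.ext h))
  have hinter : ∀ Z Z', G Z → G Z' → G (Z ∩ Z') := by
    intro Z Z' hZ hZ' x y hxy
    let z : ∀ i, (S i).toSubstructure := fun i => if i ∈ Z then x i else y i
    refine (hZ x z fun i hi => (if_pos hi).symm).trans (hZ' z y fun i hi => ?_)
    by_cases h : i ∈ Z
    · exact (if_pos h).trans (hxy i ⟨h, hi⟩)
    · exact if_neg h
  have hempty : ¬ G ∅ := fun h =>
    hT _ (isIdempotentPoint_of_hom_const φ (fun x y => h x y (by simp)) (Classical.arbitrary _))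
  have huniv : G Set.univ := fun x y h => congrArg φ (funext fun i => h i trivial)
  obtain ⟨Z, hZ, hmin⟩ := (Set.toFinite {Z | G Z}).exists_minimal ⟨_, huniv⟩
  obtain ⟨i, hi⟩ : Z.Nonempty := Set.nonempty_iff_ne_empty.2 fun h => hempty (h ▸ hZ)
  have hG : G {i} := by
    by_contra h
    exact (hmin (hinter Z _ hZ (hcompl _ h)) Set.inter_subset_left hi).2 rfl
  let x₀ : ∀ i, (S i).toSubstructure := Classical.arbitrary _
  -- Freezing the other coordinates at `x₀` need not commute with the operations, but `φ` ignores
  -- those coordinates.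
  refine ⟨i, ⟨homOfMapFun (fun s => φ (Function.update x₀ i s)) fun f s => ?_⟩⟩
  refine (hG _ (Structure.funMap f fun k => Function.update x₀ i (s k)) ?_).trans (φ.map_fun f _)
  rintro _ rfl
  simp only [Function.update_self]
  change _ = Structure.funMap f fun k => Function.update x₀ _ (s k) _
  simp only [Function.update_self]

/-- The product of a finite family of subalgebras, in the generated variety. -/
def VarFin.pi [Finite Q] {ι : Type u} [Finite ι] (S : ι → Subalgebras L Q) : VarFin L Q where
  carrier := ∀ i, (S i).toSubstructure
  mem := InVariety.of_separating
    (fun i => (S i).toSubstructure.subtype.toHom.comp (projHom (fun i => (S i).toSubstructure) i))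
    fun _ _ h => funext fun i => Subtype.ext (h i)

/-- If `X` represents the order of the subalgebras without idempotents, then `L_Q` is isomorphic to
the lattice of down-sets of `X`. -/
theorem IsSwitching.nonempty_orderIso [L.IsAlgebraic] [Finite Q] (ht : IsSwitching Q t) {X : Type*}
    [PartialOrder X] (c : X → Subalgebras L Q) (hc : ∀ x y, c x ≤ c y ↔ x ≤ y)
    (hN : ∀ x, (c x).NoIdempotent)
    (hX : ∀ S : Subalgebras L Q, S.NoIdempotent → ∃ x, S ≤ c x ∧ c x ≤ S) :
    Nonempty (HomLattice L Q ≃o LowerSet X) := by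
  let F : VarFin L Q → LowerSet X := fun B =>
    ⟨{x | ¬ Nonempty (B.carrier →[L] (c x).toSubstructure)}, fun x y hyx hx ⟨g⟩ =>
      let ⟨k⟩ := (hc y x).2 hyx
      hx ⟨k.comp g⟩⟩
  have hF : ∀ B C, F B ≤ F C ↔ B ≤ C := by
    refine fun B C => ⟨fun h => ht.le_of_forall fun S hS ⟨g⟩ => ?_, fun ⟨k⟩ x hx ⟨g⟩ => hx ⟨g.comp k⟩⟩
    obtain ⟨x, ⟨k⟩, ⟨l⟩⟩ := hX S hS
    by_contra hB
    exact h (a := x) (fun ⟨m⟩ => hB ⟨l.comp m⟩) ⟨k.comp g⟩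
  have hsurj : Function.Surjective F := by
    intro D
    -- Indexing by subalgebras rather than by `X` keeps the index type finite and in universe `u`.
    let S : {S : Subalgebras L Q // ∃ x, x ∉ D ∧ c x = S} → Subalgebras L Q := Subtype.val
    refine ⟨VarFin.pi S, ?_⟩
    refine SetLike.ext fun x => ?_
    change ¬ Nonempty ((∀ i, (S i).toSubstructure) →[L] (c x).toSubstructure) ↔ x ∈ D
    rw [not_iff_comm]
    refine ⟨fun hx => ⟨projHom (fun i => (S i).toSubstructure) ⟨c x, x, hx, rfl⟩⟩, fun ⟨φ⟩ hx => ?_⟩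
    obtain ⟨⟨_, y, hy, rfl⟩, hi⟩ := ht.exists_hom_of_pi S (c x) (hN x) φ
    exact hy (D.lower ((hc y x).1 hi) hx)
  let G : HomLattice L Q → LowerSet X := fun p => F (ofAntisymmetrization (· ≤ ·) p)
  have hG : ∀ p q, G p ≤ G q ↔ p ≤ q := fun p q =>
    (hF _ _).trans ofAntisymmetrization_le_ofAntisymmetrization_iff
  refine ⟨RelIso.ofSurjective (OrderEmbedding.ofMapLEIff G hG) fun D => ?_⟩
  obtain ⟨B, rfl⟩ := hsurj D
  have h := AntisymmRel.symm (Quotient.exact (toAntisymmetrization_ofAntisymmetrization (· ≤ ·)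
    (toAntisymmetrization (α := VarFin L Q) (· ≤ ·) B)))
  exact ⟨toAntisymmetrization (· ≤ ·) B, le_antisymm ((hF _ _).2 h.2) ((hF _ _).2 h.1)⟩

end Switching

/-- A partial order isomorphic to a distributive lattice is one. -/
theorem isDistribLatticeOrder_of_orderIso {X : Type*} {Y : Type*} [P : PartialOrder X]
    [DistribLattice Y] (e : X ≃o Y) : IsDistribLatticeOrder X :=
  ⟨{ P with
      sup := fun a b => e.symm (e a ⊔ e b)
      inf := fun a b => e.symm (e a ⊓ e b)
      le_sup_left := fun a b => e.le_symm_apply.2 le_sup_left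
      le_sup_right := fun a b => e.le_symm_apply.2 le_sup_right
      sup_le := fun a b c ha hb => e.symm_apply_le.2 (sup_le (e.le_iff_le.2 ha) (e.le_iff_le.2 hb))
      inf_le_left := fun a b => e.symm_apply_le.2 inf_le_left
      inf_le_right := fun a b => e.symm_apply_le.2 inf_le_right
      le_inf := fun a b c ha hb => e.le_symm_apply.2 (le_inf (e.le_iff_le.2 ha) (e.le_iff_le.2 hb))
      le_sup_inf := fun a b c => e.symm.le_iff_le.2 <| by
        change e (e.symm _) ⊓ e (e.symm _) ≤ e a ⊔ e (e.symm _)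
        rw [e.apply_symm_apply, e.apply_symm_apply, e.apply_symm_apply]
        exact le_sup_inf },
    fun _ _ => Iff.rfl⟩

/-! ### The two cases -/

section Main

variable {L : FirstOrder.Language.{v, w}} {Q : Type u} [L.Structure Q]

/-- A homomorphism `Q → S` carries an idempotent of `Q` into `S`; conversely an idempotent of `S`
gives a constant map `Q → S`. -/
theorem toAntisymmetrization_eq_top_iff [L.IsAlgebraic] [Nonempty Q] (h : HasTrivialSubalgebra L Q)
    (S : Subalgebras L Q) :
    toAntisymmetrization (· ≤ ·) S = (⊤ : SubOrder L Q) ↔ ¬ S.NoIdempotent := by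
  obtain ⟨a, ha⟩ := hasTrivialSubalgebra_iff.1 h
  simp only [Subalgebras.NoIdempotent, not_forall, not_not]
  constructor
  · intro hS
    obtain ⟨k⟩ : Subalgebras.whole L Q ≤ S := (Quotient.exact hS).2
    exact ⟨_, (ha.map (codHom (Hom.id L Q) ⊤ fun _ => trivial)).map k⟩
  · rintro ⟨b, hb⟩
    exact top_le_iff.1 (show Subalgebras.whole L Q ≤ S from ⟨constHom _ hb⟩)

theorem IsQuasiPrimal.nonempty_orderIso_of_not [L.IsAlgebraic] (hQ : IsQuasiPrimal L Q)
    (h : ¬ HasTrivialSubalgebra L Q) : Nonempty (HomLattice L Q ≃o LowerSet (SubOrder L Q)) := by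
  have := hQ.finite
  obtain ⟨t, ht⟩ := hQ.exists_isSwitching
  refine ht.nonempty_orderIso (ofAntisymmetrization (· ≤ ·))
    (fun _ _ => ofAntisymmetrization_le_ofAntisymmetrization_iff)
    (fun p a ha => h (hasTrivialSubalgebra_iff.2 ⟨_, ha.map (Substructure.subtype _).toHom⟩))
    fun S _ => ⟨toAntisymmetrization (· ≤ ·) S, ?_⟩
  exact (Quotient.exact (toAntisymmetrization_ofAntisymmetrization (· ≤ ·)
    (toAntisymmetrization (· ≤ ·) S))).symm

theorem IsQuasiPrimal.nonempty_orderIso_of_hasTrivialSubalgebra [L.IsAlgebraic] [Nonempty Q]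
    (hQ : IsQuasiPrimal L Q) (h : HasTrivialSubalgebra L Q) :
    Nonempty (HomLattice L Q ≃o LowerSet (SubOrderNoTop L Q)) := by
  have := hQ.finite
  obtain ⟨t, ht⟩ := hQ.exists_isSwitching
  refine ht.nonempty_orderIso (fun p => ofAntisymmetrization (· ≤ ·) p.1)
    (fun _ _ => ofAntisymmetrization_le_ofAntisymmetrization_iff) (fun p => ?_)
    fun S hS => ⟨⟨toAntisymmetrization (· ≤ ·) S,
      fun hp => (toAntisymmetrization_eq_top_iff h S).1 hp hS⟩, ?_⟩
  · by_contra hp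
    exact p.2 ((toAntisymmetrization_ofAntisymmetrization (· ≤ ·) p.1).symm.trans
      ((toAntisymmetrization_eq_top_iff h _).2 hp))
  · exact (Quotient.exact (toAntisymmetrization_ofAntisymmetrization (· ≤ ·)
      (toAntisymmetrization (· ≤ ·) S))).symm

end Main

end HomOrder

theorem theorem2p3 (L : FirstOrder.Language.{v, w}) [L.IsAlgebraic]
    (Q : Type u) [L.Structure Q] [Nonempty Q] (hQ : HomOrder.IsQuasiPrimal L Q) :
    (¬ HomOrder.HasTrivialSubalgebra L Q →
      Nonempty (HomOrder.HomLattice L Q ≃o LowerSet (HomOrder.SubOrder L Q))) ∧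
    (HomOrder.HasTrivialSubalgebra L Q →
      Nonempty (HomOrder.HomLattice L Q ≃o LowerSet (HomOrder.SubOrderNoTop L Q))) ∧
    Finite (HomOrder.HomLattice L Q) ∧
    HomOrder.IsDistribLatticeOrder (HomOrder.HomLattice L Q) := by

  have finite_lower : ∀ {X : Type u} [PartialOrder X] [Finite X], Finite (LowerSet X) := fun {X} _ _ =>
    Finite.of_injective (fun s : LowerSet X => (s : Set X)) SetLike.coe_injective
  have := hQ.finite
  have : Finite (HomOrder.SubOrder L Q) := Quotient.finite _
  refine ⟨hQ.nonempty_orderIso_of_not, hQ.nonempty_orderIso_of_hasTrivialSubalgebra, ?_⟩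
  by_cases h : HomOrder.HasTrivialSubalgebra L Q
  · obtain ⟨e⟩ := hQ.nonempty_orderIso_of_hasTrivialSubalgebra h
    have := finite_lower (X := HomOrder.SubOrderNoTop L Q)
    exact ⟨Finite.of_equiv _ e.symm.toEquiv, HomOrder.isDistribLatticeOrder_of_orderIso e⟩
  · obtain ⟨e⟩ := hQ.nonempty_orderIso_of_not h
    have := finite_lower (X := HomOrder.SubOrder L Q)
    exact ⟨Finite.of_equiv _ e.symm.toEquiv, HomOrder.isDistribLatticeOrder_of_orderIso e⟩
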